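/- Let $p\ge 1$ and $m,n$ be integers with $m+p\le n$. Let $\mathbf{x}:\mathbb{R}^p\to\mathbb{C}^n$ have partial derivatives at $\boldsymbol\theta\in\mathbb{R}^p$, let $\mathbf{G}=[\partial\mathbf{x}/\partial\theta_1,\dots,\partial\mathbf{x}/\partial\theta_p]\in\mathbb{C}^{n\times p}$ be the matrix of these derivatives at $\boldsymbol\theta$, let $\sigma>0$, and suppose that the Fisher information matrix $\mathbf{J}=\frac{1}{\sigma^2}\mathbf{G}^H\mathbf{G}$ (of the model $\mathbf{y}\sim\mathcal{CN}(\mathbf{x}(\boldsymbol\theta),\sigma^2\mathbf{I}_n)$) is invertible. Let $\boldsymbol\Phi$ be a random $m\times n$ complex matrix that almost surely has full row rank $m$ and whose distribution is right-unitarily invariant, i.e. $\boldsymbol\Phi\mathbf{U}$ has the same distribution as $\boldsymbol\Phi$ for every unitary $\mathbf{U}\in\mathbb{C}^{n\times n}$ (for example, $\boldsymbol\Phi$ with i.i.d. $\mathcal{CN}(0,1)$ entries). Let $$\hat{\mathbf{J}}=\frac{1}{\sigma^2}\hat{\mathbf{G}}^H\hat{\mathbf{G}},\qquad \hat{\mathbf{G}}=\mathbf{P}_{\boldsymbol\Phi^H}\mathbf{G},\qquad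 \mathbf{P}_{\boldsymbol\Phi^H}=\boldsymbol\Phi^H(\boldsymbol\Phi\boldsymbol\Phi^H)^{-1}\boldsymbol\Phi,$$ be the Fisher information matrix of the compressed data $\boldsymbol\Phi\mathbf{y}$. Then for every $i\in\{1,\dots,p\}$: * if $m>p$, then $\hat{\mathbf{J}}$ is almost surely invertible, $(\hat{\mathbf{J}}^{-1})_{ii}$ is integrable, and $$E[(\hat{\mathbf{J}}^{-1})_{ii}]=\frac{n-p}{m-p}\,(\mathbf{J}^{-1})_{ii};$$ * if $m>p+1$, then $(\hat{\mathbf{J}}^{-1})_{ii}$ is square integrable, and $$\mathrm{var}[(\hat{\mathbf{J}}^{-1})_{ii}]=\frac{(n-m)(n-p)}{(m-p-1)(m-p)^2}\,\big((\mathbf{J}^{-1})_{ii}\big)^2.$$ -/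

import Mathlib

open MeasureTheory ProbabilityTheory
open scoped Matrix

noncomputable section

namespace CompressedCRB

/-- The matrix `G = [g₁, …, g_p]` whose `i`-th column `g_i = ∂x/∂θ_i` is the partial derivative
at `θ` of the mean vector `x` with respect to the `i`-th (real) parameter. -/
def sensitivityMatrix {n p : ℕ} (x : (Fin p → ℝ) → (Fin n → ℂ)) (θ : Fin p → ℝ) :
    Matrix (Fin n) (Fin p) ℂ :=
  Matrix.of fun k i => lineDeriv ℝ x θ (Pi.single i 1) k

/-- The Fisher information matrix `J = (1/σ²) Gᴴ G` for the mean of `CN(x(θ), σ² I)`, in terms of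
the sensitivity matrix `G` of the mean. -/
def fisherInformation {n p : ℕ} (σ : ℝ) (G : Matrix (Fin n) (Fin p) ℂ) :
    Matrix (Fin p) (Fin p) ℂ :=
  (1 / (σ : ℂ) ^ 2) • (Gᴴ * G)

/-- `P = Φᴴ (Φ Φᴴ)⁻¹ Φ`, the orthogonal projection onto the row span of a matrix `Φ` of full
row rank. -/
def rowProjection {m n : ℕ} (Φ : Matrix (Fin m) (Fin n) ℂ) : Matrix (Fin n) (Fin n) ℂ :=
  Φᴴ * (Φ * Φᴴ)⁻¹ * Φ

/-- The Fisher information matrix `Ĵ = (1/σ²) Ĝᴴ Ĝ`, with `Ĝ = P G`, after compression by `Φ`. -/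
def compressedFisherInformation {m n p : ℕ} (σ : ℝ) (Φ : Matrix (Fin m) (Fin n) ℂ)
    (G : Matrix (Fin n) (Fin p) ℂ) : Matrix (Fin p) (Fin p) ℂ :=
  fisherInformation σ (rowProjection Φ * G)

/-- The Cramér-Rao bound on the `i`-th parameter: the `i`-th diagonal entry of `J⁻¹`, as a real
number. For a Fisher information matrix that entry is real, see `coe_crb`. -/
def crb {p : ℕ} (J : Matrix (Fin p) (Fin p) ℂ) (i : Fin p) : ℝ :=
  (J⁻¹ i i).re

theorem isHermitian_fisherInformation {n p : ℕ} (σ : ℝ) (G : Matrix (Fin n) (Fin p) ℂ) :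
    (fisherInformation σ G).IsHermitian := by
  unfold fisherInformation Matrix.IsHermitian
  rw [Matrix.conjTranspose_smul, Matrix.conjTranspose_mul, Matrix.conjTranspose_conjTranspose]
  simp

theorem coe_crb {n p : ℕ} (σ : ℝ) (G : Matrix (Fin n) (Fin p) ℂ) (i : Fin p) :
    ((crb (fisherInformation σ G) i : ℝ) : ℂ) = (fisherInformation σ G)⁻¹ i i :=
  (isHermitian_fisherInformation σ G).inv.coe_re_apply_self i

/-- The random matrix `Φ` on `(Ω, μ)` has a right-unitarily invariant distribution: `Φ U` has the
same law as `Φ` for every unitary `n × n` matrix `U`. A matrix is regarded as the family of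
its entries, with the product (Borel) σ-algebra. -/
structure IsRightUnitarilyInvariant {Ω : Type*} [MeasurableSpace Ω] (μ : Measure Ω) {m n : ℕ}
    (Φ : Ω → Matrix (Fin m) (Fin n) ℂ) : Prop where
  aemeasurable : AEMeasurable (fun ω (k : Fin m) (l : Fin n) => Φ ω k l) μ
  map_mul_eq : ∀ U ∈ Matrix.unitaryGroup (Fin n) ℂ,
    μ.map (fun ω (k : Fin m) (l : Fin n) => (Φ ω * U) k l) =
      μ.map (fun ω (k : Fin m) (l : Fin n) => Φ ω k l)

end CompressedCRB

end

/-! Write `v j` for the columns of `G`, `W` for the span of the columns other than `v i`, and `K`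
for the row space of `Φ`. The inverse Gram matrix turns both bounds into distances: `σ²/‖P v_i‖²`
with `P` the projection onto `Wᗮ` (dimension `n - p + 1`), respectively onto the residual space `R`,
the part of `K` orthogonal to the image of `W` in `K` (dimension `m - p + 1` almost surely).

To find the `s`-th moment, replace `v i` by a variable vector `y` and set `H y = E[(σ²/‖P_R y‖²)^s]
· ‖P_{Wᗮ} y‖^(2s)`. Both projections kill `W` and the powers of a scalar factor cancel, so `H` is
unchanged by translations along `W` and by nonzero scalars; unitary invariance of `Φ` gives
invariance under isometries fixing `W`. These symmetries act transitively off `W`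
(`eq_of_invariant_of_notMem`), hence `H` is constant there.

The constant comes from averaging over a Gaussian `y`, which needs no law for `K`. Under the
normalised weight `exp(-‖y‖²)`, `‖P_L y‖²` is Gamma distributed with shape the complex dimension `k`
of `L`, so its moment of order `-s` is `Γ(k-s)/Γ(k)` (`lintegral_exp_mul_rpow_neg`). Tonelli equates
the average over `y` for `Wᗮ` with that for `R`, giving a ratio of Gamma quotients
(`lintegral_crb_rpow`). The cases `s = 1, 2` give the mean and the variance.

Almost sure invertibility uses the same scheme, with the probability of degeneracy in place of the
moment. -/

namespace CompressedCRB

open scoped ENNReal InnerProductSpace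

/-! ### Negative moments of projections under a Gaussian weight -/

section GaussianMoments

variable {E : Type*} [NormedAddCommGroup E] [InnerProductSpace ℂ E] [FiniteDimensional ℂ E]

/-- Scaling by `c` along `K` and by `1` along `Kᗮ`. -/
noncomputable def scaleAlong (K : Submodule ℂ E) (c : ℂ) : E →ₗ[ℂ] E :=
  LinearMap.id + (c - 1) • (K.starProjection : E →ₗ[ℂ] E)

theorem scaleAlong_apply (K : Submodule ℂ E) (c : ℂ) (x : E) :
    scaleAlong K c x = x + (c - 1) • K.starProjection x := rfl

theorem norm_sq_scaleAlong (K : Submodule ℂ E) (c : ℂ) (x : E) :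
    ‖scaleAlong K c x‖ ^ 2 = ‖x‖ ^ 2 + (‖c‖ ^ 2 - 1) * ‖K.starProjection x‖ ^ 2 := by
  have h1 : K.starProjection (scaleAlong K c x) = c • K.starProjection x := by
    have h : K.starProjection (K.starProjection x) = K.starProjection x :=
      Submodule.starProjection_eq_self_iff.2 (Submodule.starProjection_apply_mem _ _)
    rw [scaleAlong_apply, map_add, map_smul, h, sub_smul, one_smul]
    abel
  have h2 : Kᗮ.starProjection (scaleAlong K c x) = Kᗮ.starProjection x := by
    rw [Submodule.starProjection_orthogonal_val, Submodule.starProjection_orthogonal_val, h1,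
      scaleAlong_apply, sub_smul, one_smul]
    abel
  rw [Submodule.norm_sq_eq_add_norm_sq_starProjection _ K, h1, h2,
    Submodule.norm_sq_eq_add_norm_sq_starProjection x K, norm_smul]
  ring

/-- The map preserves `K`, acts on it as `c`, and induces the identity on the quotient by `K`. -/
theorem det_scaleAlong (K : Submodule ℂ E) (c : ℂ) :
    LinearMap.det (scaleAlong K c) = c ^ Module.finrank ℂ K := by
  have he : K ≤ K.comap (scaleAlong K c) := fun x hx => by
    rw [Submodule.mem_comap, scaleAlong_apply]
    exact K.add_mem hx (K.smul_mem _ (Submodule.starProjection_apply_mem _ _))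
  rw [LinearMap.det_eq_det_mul_det K _ he]
  have h1 : (scaleAlong K c).restrict he = c • LinearMap.id := by
    ext x
    have : K.starProjection (x : E) = x := Submodule.starProjection_eq_self_iff.2 x.2
    simp [scaleAlong_apply, this, sub_smul]
  have h2 : K.mapQ K (scaleAlong K c) he = LinearMap.id := by
    ext x
    simp only [LinearMap.comp_apply, Submodule.mapQ_apply, LinearMap.id_comp, Submodule.mkQ_apply]
    rw [Submodule.Quotient.eq, scaleAlong_apply, add_sub_cancel_left]
    exact K.smul_mem _ (Submodule.starProjection_apply_mem _ _)
  rw [h1, h2]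
  simp [LinearMap.det_smul]

variable [MeasurableSpace E] [BorelSpace E] (γ : Measure E) [γ.IsAddHaarMeasure]

/-- Change of variables along `scaleAlong K c` with `‖c‖² = 1 + t`. The real determinant is the
squared modulus of the complex one, which is why the exponent is the complex dimension without a
factor `1/2`. -/
theorem lintegral_exp_neg_norm_sq_add (K : Submodule ℂ E) {t : ℝ} (ht : 0 ≤ t) :
    ∫⁻ x : E, ENNReal.ofReal (Real.exp (-(‖x‖ ^ 2 + t * ‖K.starProjection x‖ ^ 2))) ∂γ =
      ENNReal.ofReal ((1 + t) ^ (-(Module.finrank ℂ K : ℝ))) *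
        ∫⁻ x : E, ENNReal.ofReal (Real.exp (-‖x‖ ^ 2)) ∂γ := by
  obtain ⟨c, hc⟩ : ∃ c : ℂ, c = (Real.sqrt (1 + t) : ℝ) := ⟨_, rfl⟩
  have hcn : ‖c‖ ^ 2 = 1 + t := by
    rw [hc, Complex.norm_real, Real.norm_eq_abs, sq_abs, Real.sq_sqrt (by linarith)]
  have hdet : LinearMap.det ((scaleAlong K c).restrictScalars ℝ) =
      (1 + t) ^ (Module.finrank ℂ K) := by
    rw [LinearMap.det_restrictScalars, det_scaleAlong, Algebra.norm_complex_apply, map_pow,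
      Complex.normSq_eq_norm_sq, hcn]
  have hpos : 0 < (1 + t) ^ (Module.finrank ℂ K) := by positivity
  have hm := Measure.map_linearMap_addHaar_eq_smul_addHaar γ
    (f := (scaleAlong K c).restrictScalars ℝ) (by rw [hdet]; exact hpos.ne')
  have hcont : Continuous ((scaleAlong K c).restrictScalars ℝ) :=
    LinearMap.continuous_of_finiteDimensional _
  have h := lintegral_map (μ := γ)
    (f := fun x : E => ENNReal.ofReal (Real.exp (-‖x‖ ^ 2))) (by fun_prop) hcont.measurable
  rw [hm, lintegral_smul_measure, hdet] at h
  rw [Real.rpow_neg (by linarith), Real.rpow_natCast]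
  rw [abs_of_pos (inv_pos.2 hpos), smul_eq_mul] at h
  rw [h]
  refine lintegral_congr fun x => ?_
  rw [LinearMap.restrictScalars_apply, norm_sq_scaleAlong, hcn]
  ring_nf

theorem lintegral_rpow_mul_exp_neg_mul_Ioi {a r : ℝ} (ha : 0 < a) (hr : 0 < r) :
    ∫⁻ t in Set.Ioi (0 : ℝ), ENNReal.ofReal (t ^ (a - 1) * Real.exp (-(r * t))) =
      ENNReal.ofReal ((1 / r) ^ a * Real.Gamma a) := by
  rw [← Real.integral_rpow_mul_exp_neg_mul_Ioi ha hr, ofReal_integral_eq_lintegral_ofReal]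
  -- A non-integrable function would have Bochner integral `0`, whereas the known value is positive.
  · by_contra h
    have := integral_undef h
    rw [Real.integral_rpow_mul_exp_neg_mul_Ioi ha hr] at this
    have := Real.Gamma_pos_of_pos ha
    have : 0 < (1 / r) ^ a * Real.Gamma a := by positivity
    linarith
  · filter_upwards [ae_restrict_mem measurableSet_Ioi] with t ht
    have : (0:ℝ) < t := ht
    positivity

/-- The Beta integral: expand `Γ(k) (1+t)^(-k)` as a Gamma integral in `u`, swap, and integrate
first in `t`, then in `u`. -/
theorem lintegral_rpow_mul_one_add_rpow_neg {s k : ℝ} (hs : 0 < s) (hk : s < k) :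
    ENNReal.ofReal (Real.Gamma k) *
      ∫⁻ t in Set.Ioi (0 : ℝ), ENNReal.ofReal (t ^ (s - 1) * (1 + t) ^ (-k)) =
      ENNReal.ofReal (Real.Gamma s * Real.Gamma (k - s)) := by
  have hk0 : 0 < k := hs.trans hk
  have h1 : ∀ t ∈ Set.Ioi (0 : ℝ),
      ENNReal.ofReal (Real.Gamma k) * ENNReal.ofReal (t ^ (s - 1) * (1 + t) ^ (-k)) =
      ∫⁻ u in Set.Ioi (0 : ℝ), ENNReal.ofReal (t ^ (s - 1)) *
        ENNReal.ofReal (u ^ (k - 1) * Real.exp (-((1 + t) * u))) := by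
    intro t ht
    have ht' : (0 : ℝ) < t := ht
    rw [lintegral_const_mul _ (by fun_prop),
      lintegral_rpow_mul_exp_neg_mul_Ioi hk0 (by linarith : 0 < 1 + t),
      ← ENNReal.ofReal_mul (Real.Gamma_pos_of_pos hk0).le, ← ENNReal.ofReal_mul (by positivity),
      Real.rpow_neg (by linarith), one_div, Real.inv_rpow (by linarith)]
    ring_nf
  rw [← lintegral_const_mul _ (by fun_prop), setLIntegral_congr_fun measurableSet_Ioi h1,
    lintegral_lintegral_swap (by fun_prop)]
  have h2 : ∀ u ∈ Set.Ioi (0 : ℝ),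
      ∫⁻ t in Set.Ioi (0 : ℝ), ENNReal.ofReal (t ^ (s - 1)) *
        ENNReal.ofReal (u ^ (k - 1) * Real.exp (-((1 + t) * u))) =
      ENNReal.ofReal (Real.Gamma s) *
        ENNReal.ofReal (u ^ ((k - s) - 1) * Real.exp (-(1 * u))) := by
    intro u hu
    have hu' : (0 : ℝ) < u := hu
    have : ∀ t ∈ Set.Ioi (0 : ℝ), ENNReal.ofReal (t ^ (s - 1)) *
        ENNReal.ofReal (u ^ (k - 1) * Real.exp (-((1 + t) * u))) =
        ENNReal.ofReal (u ^ (k - 1) * Real.exp (-u)) *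
          ENNReal.ofReal (t ^ (s - 1) * Real.exp (-(u * t))) := by
      intro t ht
      have ht' : (0 : ℝ) < t := ht
      rw [← ENNReal.ofReal_mul (by positivity), ← ENNReal.ofReal_mul (by positivity),
        show -((1 + t) * u) = -u + -(u * t) by ring, Real.exp_add]
      ring_nf
    rw [setLIntegral_congr_fun measurableSet_Ioi this, lintegral_const_mul _ (by fun_prop),
      lintegral_rpow_mul_exp_neg_mul_Ioi hs hu', ← ENNReal.ofReal_mul (by positivity),
      ← ENNReal.ofReal_mul (Real.Gamma_pos_of_pos hs).le, one_div, Real.inv_rpow hu'.le,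
      show k - s - 1 = (k - 1) - s by ring, Real.rpow_sub hu' (k - 1) s, one_mul]
    ring_nf
  rw [setLIntegral_congr_fun measurableSet_Ioi h2, lintegral_const_mul _ (by fun_prop),
    lintegral_rpow_mul_exp_neg_mul_Ioi (by linarith) one_pos,
    ← ENNReal.ofReal_mul (Real.Gamma_pos_of_pos hs).le]
  simp

/-- The kernel `Kᗮ` is a proper real subspace, hence a null set for Haar measure. -/
theorem ae_starProjection_ne_zero {K : Submodule ℂ E} (hK : K ≠ ⊥) :
    ∀ᵐ x ∂γ, K.starProjection x ≠ 0 := by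
  have h : (Kᗮ).restrictScalars ℝ ≠ ⊤ := by
    intro h
    apply hK
    rw [← Submodule.orthogonal_eq_top_iff, Submodule.eq_top_iff']
    exact fun x => (Submodule.eq_top_iff'.1 h x)
  have := Measure.addHaar_submodule γ _ h
  refine measure_mono_null (fun x hx => ?_) this
  simpa [Submodule.starProjection_apply_eq_zero_iff] using hx

theorem lintegral_exp_neg_norm_sq_ne_zero {V : Type*} [NormedAddCommGroup V] [MeasurableSpace V]
    [BorelSpace V] (γ : Measure V) [γ.IsAddHaarMeasure] :
    ∫⁻ x : V, ENNReal.ofReal (Real.exp (-‖x‖ ^ 2)) ∂γ ≠ 0 := by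
  rw [Ne, lintegral_eq_zero_iff (by fun_prop)]
  intro h
  have : ∀ᵐ x ∂γ, False := by
    filter_upwards [h] with x hx
    exact (Real.exp_pos _).not_ge (by simpa using hx)
  rw [Filter.eventually_false_iff_eq_bot, ae_eq_bot] at this
  exact NeZero.ne γ this

theorem lintegral_exp_neg_norm_sq_ne_top {V : Type*} [NormedAddCommGroup V] [InnerProductSpace ℝ V]
    [FiniteDimensional ℝ V] [MeasurableSpace V] [BorelSpace V] :
    ∫⁻ x : V, ENNReal.ofReal (Real.exp (-‖x‖ ^ 2)) ≠ ∞ := by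
  have h : Integrable (fun x : V => Real.exp (-‖x‖ ^ 2)) := by
    by_contra h
    have h0 := integral_undef h
    have h1 := GaussianFourier.integral_rexp_neg_mul_sq_norm (V := V) one_pos
    simp only [neg_mul, one_mul] at h1
    rw [h1] at h0
    have : 0 < (Real.pi / 1) ^ (Module.finrank ℝ V / 2 : ℝ) := by positivity
    linarith
  exact (h.lintegral_lt_top).ne

/-- Subordination: `Γ(s) r^(-s)` is the integral of `t^(s-1) exp(-tr)`. With `r = ‖P_K x‖²`, Tonelli
leaves the Gaussian integral above for each `t`, and then a Beta integral. -/
theorem lintegral_exp_mul_rpow_neg (K : Submodule ℂ E) {s : ℝ} (hs : 0 < s)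
    (hk : s < Module.finrank ℂ K) :
    ∫⁻ x : E, ENNReal.ofReal (Real.exp (-‖x‖ ^ 2)) *
        ENNReal.ofReal (((‖K.starProjection x‖ ^ 2)⁻¹) ^ s) ∂γ =
      ENNReal.ofReal (Real.Gamma (Module.finrank ℂ K - s) / Real.Gamma (Module.finrank ℂ K)) *
        ∫⁻ x : E, ENNReal.ofReal (Real.exp (-‖x‖ ^ 2)) ∂γ := by
  have hK : K ≠ ⊥ := by
    rintro rfl
    simp at hk
    linarith
  have hΓk := Real.Gamma_pos_of_pos (hs.trans hk)
  have hΓs := Real.Gamma_pos_of_pos hs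
  have hΓks := Real.Gamma_pos_of_pos (sub_pos.2 hk)
  set k : ℝ := (Module.finrank ℂ K : ℝ) with hkdef
  have h1 : ∀ᵐ x ∂γ, ENNReal.ofReal (Real.Gamma s) * (ENNReal.ofReal (Real.exp (-‖x‖ ^ 2)) *
        ENNReal.ofReal (((‖K.starProjection x‖ ^ 2)⁻¹) ^ s)) =
      ∫⁻ t in Set.Ioi (0 : ℝ), ENNReal.ofReal (t ^ (s - 1)) *
        ENNReal.ofReal (Real.exp (-(‖x‖ ^ 2 + t * ‖K.starProjection x‖ ^ 2))) := by
    filter_upwards [ae_starProjection_ne_zero γ hK] with x hx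
    have hx' : 0 < ‖K.starProjection x‖ ^ 2 := by positivity
    have : ∀ t ∈ Set.Ioi (0 : ℝ), ENNReal.ofReal (t ^ (s - 1)) *
        ENNReal.ofReal (Real.exp (-(‖x‖ ^ 2 + t * ‖K.starProjection x‖ ^ 2))) =
        ENNReal.ofReal (Real.exp (-‖x‖ ^ 2)) *
          ENNReal.ofReal (t ^ (s - 1) * Real.exp (-(‖K.starProjection x‖ ^ 2 * t))) := by
      intro t ht
      have ht' : (0 : ℝ) < t := ht
      rw [← ENNReal.ofReal_mul (by positivity), ← ENNReal.ofReal_mul (by positivity),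
        neg_add, Real.exp_add]
      ring_nf
    rw [setLIntegral_congr_fun measurableSet_Ioi this, lintegral_const_mul _ (by fun_prop),
      lintegral_rpow_mul_exp_neg_mul_Ioi hs hx', mul_left_comm, ← ENNReal.ofReal_mul hΓs.le,
      one_div, mul_comm (Real.Gamma s)]
  have h2 : ∀ t ∈ Set.Ioi (0 : ℝ), ∫⁻ x : E, ENNReal.ofReal (t ^ (s - 1)) *
        ENNReal.ofReal (Real.exp (-(‖x‖ ^ 2 + t * ‖K.starProjection x‖ ^ 2))) ∂γ =
      ENNReal.ofReal (t ^ (s - 1) * (1 + t) ^ (-k)) *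
        ∫⁻ x : E, ENNReal.ofReal (Real.exp (-‖x‖ ^ 2)) ∂γ := by
    intro t ht
    have ht' : (0 : ℝ) < t := ht
    rw [lintegral_const_mul _ (by fun_prop), lintegral_exp_neg_norm_sq_add γ K ht'.le,
      ENNReal.ofReal_mul (by positivity), mul_assoc]
  have h3 : ENNReal.ofReal (Real.Gamma s) * ∫⁻ x : E, ENNReal.ofReal (Real.exp (-‖x‖ ^ 2)) *
        ENNReal.ofReal (((‖K.starProjection x‖ ^ 2)⁻¹) ^ s) ∂γ =
      (∫⁻ t in Set.Ioi (0 : ℝ), ENNReal.ofReal (t ^ (s - 1) * (1 + t) ^ (-k))) *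
        ∫⁻ x : E, ENNReal.ofReal (Real.exp (-‖x‖ ^ 2)) ∂γ := by
    rw [← lintegral_const_mul _ (by fun_prop), lintegral_congr_ae h1,
      lintegral_lintegral_swap (by fun_prop), setLIntegral_congr_fun measurableSet_Ioi h2,
      lintegral_mul_const _ (by fun_prop)]
  have h4 := lintegral_rpow_mul_one_add_rpow_neg hs hk
  have hs0 : ENNReal.ofReal (Real.Gamma s) ≠ 0 := by simpa using hΓs
  have hk0 : ENNReal.ofReal (Real.Gamma k) ≠ 0 := by simpa using hΓk
  rw [← ENNReal.mul_right_inj hs0 ENNReal.ofReal_ne_top, h3, ← mul_assoc,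
    ← ENNReal.ofReal_mul hΓs.le]
  congr 1
  rw [← ENNReal.mul_right_inj hk0 ENNReal.ofReal_ne_top, h4, ← ENNReal.ofReal_mul hΓk.le]
  congr 1
  field_simp

end GaussianMoments

/-! ### Isometries fixing a subspace, residual spaces, Gram matrices -/

section Geometry

variable {E : Type*} [NormedAddCommGroup E] [InnerProductSpace ℂ E]

/-- Over `ℂ`, equal norms alone do not make `a - b` orthogonal to `a + b`; a real inner product is
also needed. The reflection then negates the first and fixes the second. -/
theorem reflection_orthogonal_span_sub {a b : E} (hab : ‖a‖ = ‖b‖) (him : (⟪a, b⟫_ℂ).im = 0) :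
    (ℂ ∙ (a - b))ᗮ.reflection a = b := by
  have hsymm : ⟪b, a⟫_ℂ = ⟪a, b⟫_ℂ := by
    rw [← inner_conj_symm b a]
    exact Complex.conj_eq_iff_im.2 him
  have h1 : (ℂ ∙ (a - b))ᗮ.reflection (a - b) = -(a - b) :=
    Submodule.reflection_orthogonalComplement_singleton_eq_neg _
  have h2 : (ℂ ∙ (a - b))ᗮ.reflection (a + b) = a + b := by
    apply Submodule.reflection_mem_subspace_eq_self
    rw [Submodule.mem_orthogonal_singleton_iff_inner_right]
    rw [inner_sub_left, inner_add_right, inner_add_right, hsymm, inner_self_eq_norm_sq_to_K,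
      inner_self_eq_norm_sq_to_K, hab]
    ring
  have h3 : (2 : ℂ) • (ℂ ∙ (a - b))ᗮ.reflection a = (2 : ℂ) • b := by
    rw [← map_smul, show (2 : ℂ) • a = (a - b) + (a + b) by rw [two_smul]; abel, map_add, h1, h2,
      two_smul]
    abel
  exact smul_right_injective E (two_ne_zero (α := ℂ)) h3

theorem exists_unit_mul_im_eq_zero (z : ℂ) : ∃ u : ℂ, ‖u‖ = 1 ∧ (u * z).im = 0 := by
  rcases eq_or_ne z 0 with rfl | hz
  · exact ⟨1, by simp⟩
  · refine ⟨(starRingEnd ℂ z) / ‖z‖, ?_, ?_⟩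
    · simp [hz]
    · rw [div_mul_eq_mul_div, mul_comm, Complex.mul_conj, ← Complex.ofReal_div]
      exact Complex.ofReal_im _

variable [FiniteDimensional ℂ E]

/-- A function that is invariant under translations by `W`, nonzero scalars, and the isometries
fixing `W` pointwise is constant on the complement of `W`. -/
theorem eq_of_invariant_of_notMem {α : Type*} (W : Submodule ℂ E) (f : E → α)
    (hU : ∀ U : E ≃ₗᵢ[ℂ] E, (∀ w ∈ W, U w = w) → ∀ x, f (U x) = f x)
    (hW : ∀ x, ∀ w ∈ W, f (x + w) = f x) (hc : ∀ (c : ℂ) x, c ≠ 0 → f (c • x) = f x)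
    {x y : E} (hx : x ∉ W) (hy : y ∉ W) : f x = f y := by
  have hproj : ∀ z, f z = f (Wᗮ.starProjection z) := fun z => by
    rw [← hW (Wᗮ.starProjection z) (W.starProjection z) (Submodule.starProjection_apply_mem _ _),
      add_comm, Submodule.starProjection_add_starProjection_orthogonal]
  have hne : ∀ z, z ∉ W → Wᗮ.starProjection z ≠ 0 := fun z hz h => by
    rw [Submodule.starProjection_apply_eq_zero_iff, Submodule.orthogonal_orthogonal] at h
    exact hz h
  set a := Wᗮ.starProjection x with ha
  set b := Wᗮ.starProjection y with hb
  have ha0 : ‖a‖ ≠ 0 := norm_ne_zero_iff.2 (hne x hx)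
  have hb0 : ‖b‖ ≠ 0 := norm_ne_zero_iff.2 (hne y hy)
  obtain ⟨u, hu, him⟩ := exists_unit_mul_im_eq_zero (⟪a, b⟫_ℂ)
  have hu0 : u ≠ 0 := fun h => by simp [h] at hu
  -- rescale `y` so that the two projections have equal norms and real inner product
  set c : ℂ := u * ((‖a‖ / ‖b‖ : ℝ) : ℂ) with hcdef
  have hc0 : c ≠ 0 := mul_ne_zero hu0 (by exact_mod_cast div_ne_zero ha0 hb0)
  have hnorm : ‖a‖ = ‖c • b‖ := by
    rw [norm_smul, hcdef, norm_mul, hu, one_mul, Complex.norm_real, Real.norm_eq_abs,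
      abs_of_nonneg (by positivity), div_mul_cancel₀ _ hb0]
  have him' : (⟪a, c • b⟫_ℂ).im = 0 := by
    rw [inner_smul_right, hcdef, mul_right_comm, Complex.im_mul_ofReal, him, zero_mul]
  have haW : a ∈ Wᗮ := Submodule.starProjection_apply_mem _ _
  have hbW : c • b ∈ Wᗮ := Submodule.smul_mem _ _ (Submodule.starProjection_apply_mem _ _)
  -- The mirror's normal lies in `Wᗮ`, so the mirror contains `W`.
  have hfix : ∀ w ∈ W, (ℂ ∙ (a - c • b))ᗮ.reflection w = w := fun w hw => by
    apply Submodule.reflection_mem_subspace_eq_self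
    rw [Submodule.mem_orthogonal_singleton_iff_inner_left]
    exact (Submodule.sub_mem _ haW hbW) w hw
  rw [hproj x, hproj y, ← ha, ← hb, ← hU _ hfix a, reflection_orthogonal_span_sub hnorm him',
    hc c b hc0]

/-- The orthogonal complement of the image of `W` inside `K`: projecting onto it amounts to
projecting onto `K` and then removing the component along the image of `W`. -/
theorem starProjection_orthogonal_map_starProjection (K W : Submodule ℂ E) (x : E) :
    (W.map (K.starProjection : E →ₗ[ℂ] E))ᗮ.starProjection (K.starProjection x) =
      ((W.map (K.starProjection : E →ₗ[ℂ] E))ᗮ ⊓ K).starProjection x := by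
  set L := W.map (K.starProjection : E →ₗ[ℂ] E) with hL
  have hLK : L ≤ K := by
    rintro _ ⟨w, -, rfl⟩
    exact Submodule.starProjection_apply_mem _ _
  refine (Submodule.eq_starProjection_of_mem_orthogonal (K := Lᗮ ⊓ K)
    ⟨Submodule.starProjection_apply_mem _ _, ?_⟩ ?_).symm
  · rw [SetLike.mem_coe, Submodule.starProjection_orthogonal_val]
    exact K.sub_mem (Submodule.starProjection_apply_mem _ _)
      (hLK (Submodule.starProjection_apply_mem _ _))
  · rw [Submodule.starProjection_orthogonal_val, ← sub_add]
    refine Submodule.add_mem _ ?_ ?_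
    · exact Submodule.orthogonal_le inf_le_right (Submodule.sub_starProjection_mem_orthogonal x)
    · exact Submodule.orthogonal_le inf_le_left
        (Submodule.le_orthogonal_orthogonal _ (Submodule.starProjection_apply_mem _ _))

/-- The projected vectors form a basis of the image, whose complement is taken inside `K`. -/
theorem finrank_orthogonal_inf_map_span (K : Submodule ℂ E) {ι : Type*} [Fintype ι]
    {v : ι → E} (hv : LinearIndependent ℂ fun j => K.starProjection (v j)) :
    Fintype.card ι + Module.finrank ℂ
      ↥(((Submodule.span ℂ (Set.range v)).map (K.starProjection : E →ₗ[ℂ] E))ᗮ ⊓ K) =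
      Module.finrank ℂ K := by
  have hle : (Submodule.span ℂ (Set.range v)).map (K.starProjection : E →ₗ[ℂ] E) ≤ K := by
    rintro _ ⟨w, -, rfl⟩
    exact Submodule.starProjection_apply_mem _ _
  rw [← Submodule.finrank_add_inf_finrank_orthogonal hle]
  congr 1
  rw [Submodule.map_span, ← Set.range_comp]
  exact (finrank_span_eq_card hv).symm

theorem starProjection_eq_zero_iff_mem_map (K W : Submodule ℂ E) (x : E) :
    ((W.map (K.starProjection : E →ₗ[ℂ] E))ᗮ ⊓ K).starProjection x = 0 ↔
      K.starProjection x ∈ W.map (K.starProjection : E →ₗ[ℂ] E) := by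
  rw [← starProjection_orthogonal_map_starProjection, Submodule.starProjection_apply_eq_zero_iff,
    Submodule.orthogonal_orthogonal]

theorem starProjection_orthogonal_map_inf_eq_zero (K W : Submodule ℂ E) {w : E} (hw : w ∈ W) :
    ((W.map (K.starProjection : E →ₗ[ℂ] E))ᗮ ⊓ K).starProjection w = 0 :=
  (starProjection_eq_zero_iff_mem_map K W w).2 ⟨w, hw, rfl⟩

/-- A diagonal entry of the inverse of a Gram matrix. -/
theorem inv_gram_apply_self {ι : Type*} [Fintype ι] [DecidableEq ι] {v : ι → E}
    (hv : LinearIndependent ℂ v) (i : ι) :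
    (Matrix.gram ℂ v)⁻¹ i i =
      ((((‖(Submodule.span ℂ (v '' {i}ᶜ))ᗮ.starProjection (v i)‖ ^ 2)⁻¹ : ℝ)) : ℂ) := by
  have hdet : IsUnit (Matrix.gram ℂ v).det :=
    isUnit_iff_ne_zero.2 (Matrix.det_gram_ne_zero_iff_linearIndependent.2 hv)
  set M := Matrix.gram ℂ v with hM
  set W := Submodule.span ℂ (v '' {i}ᶜ) with hW
  -- `w` is the dual vector of `v i`: it pairs to `1` with `v i` and to `0` with the others. So `w ∈
  -- Wᗮ`; projecting its expansion onto `Wᗮ` keeps only the `i`-th term, and pairing with `v i`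
  -- gives the entry.
  set w : E := ∑ j, M⁻¹ j i • v j with hw
  have hdual : ∀ k, ⟪v k, w⟫_ℂ = if k = i then 1 else 0 := fun k => by
    have := congrFun (congrFun (Matrix.mul_nonsing_inv M hdet) k) i
    rw [Matrix.mul_apply, Matrix.one_apply] at this
    rw [← this, hw, inner_sum]
    refine Finset.sum_congr rfl fun j _ => ?_
    rw [inner_smul_right, hM, Matrix.gram_apply, mul_comm]
  have hwW : w ∈ Wᗮ := by
    rw [hW, Submodule.mem_orthogonal]
    intro u hu
    induction hu using Submodule.span_induction with
    | mem u hu =>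
      obtain ⟨k, hk, rfl⟩ := hu
      rw [hdual, if_neg (by simpa using hk)]
    | zero => simp
    | add a b _ _ ha hb => rw [inner_add_left, ha, hb, add_zero]
    | smul c a _ ha => rw [inner_smul_left, ha, mul_zero]
  have hwproj : w = M⁻¹ i i • Wᗮ.starProjection (v i) := by
    have h1 : Wᗮ.starProjection w = w := Submodule.starProjection_eq_self_iff.2 hwW
    rw [← h1, hw, map_sum, Finset.sum_eq_single i]
    · rw [map_smul]
    · intro j _ hj
      rw [map_smul, Submodule.starProjection_orthogonal_apply_eq_zero, smul_zero]
      exact Submodule.subset_span ⟨j, by simpa using hj, rfl⟩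
    · simp
  have hinner : ⟪Wᗮ.starProjection (v i), w⟫_ℂ = 1 := by
    rw [Submodule.inner_starProjection_left_eq_right, Submodule.starProjection_eq_self_iff.2 hwW,
      hdual, if_pos rfl]
  rw [hwproj, inner_smul_right, inner_self_eq_norm_sq_to_K] at hinner
  rw [eq_inv_of_mul_eq_one_left hinner]
  push_cast
  rfl

end Geometry

/-! ### From Fisher matrices to projections of vectors; unitary action; measurability -/

section Matrices

variable {m n p : ℕ}

/-- The matrix whose columns are the vectors `v j`. -/
def colMatrix {ι : Type*} (v : ι → EuclideanSpace ℂ (Fin n)) : Matrix (Fin n) ι ℂ :=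
  Matrix.of fun k j => v j k

/-- The row space of `Φ`, realised as the range of `rowProjection Φ`. -/
noncomputable def rowSpace (Φ : Matrix (Fin m) (Fin n) ℂ) :
    Submodule ℂ (EuclideanSpace ℂ (Fin n)) :=
  LinearMap.range (Matrix.toEuclideanLin (rowProjection Φ))

theorem conjTranspose_colMatrix_mul_colMatrix (v : Fin p → EuclideanSpace ℂ (Fin n)) :
    (colMatrix v)ᴴ * colMatrix v = Matrix.gram ℂ v := by
  ext i j
  simp [Matrix.mul_apply, colMatrix, Matrix.gram_apply, PiLp.inner_apply, mul_comm]

theorem mul_colMatrix (A : Matrix (Fin n) (Fin n) ℂ) (v : Fin p → EuclideanSpace ℂ (Fin n)) :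
    A * colMatrix v = colMatrix fun j => Matrix.toEuclideanLin A (v j) := by
  ext i j
  simp [Matrix.mul_apply, colMatrix, Matrix.mulVec, dotProduct]

theorem fisherInformation_colMatrix (σ : ℝ) (v : Fin p → EuclideanSpace ℂ (Fin n)) :
    fisherInformation σ (colMatrix v) = (1 / (σ : ℂ) ^ 2) • Matrix.gram ℂ v := by
  rw [fisherInformation, conjTranspose_colMatrix_mul_colMatrix]

theorem isUnit_fisherInformation_iff {σ : ℝ} (hσ : 0 < σ) (v : Fin p → EuclideanSpace ℂ (Fin n)) :
    IsUnit (fisherInformation σ (colMatrix v)) ↔ LinearIndependent ℂ v := by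
  have h : (1 / (σ : ℂ) ^ 2) ≠ 0 := by simp [hσ.ne']
  rw [fisherInformation_colMatrix, Matrix.isUnit_iff_isUnit_det, Matrix.det_smul,
    ← Matrix.det_gram_ne_zero_iff_linearIndependent (𝕜 := ℂ), isUnit_iff_ne_zero,
    mul_ne_zero_iff, and_iff_right (pow_ne_zero _ h)]

theorem crb_fisherInformation {σ : ℝ} (hσ : 0 < σ) {v : Fin p → EuclideanSpace ℂ (Fin n)}
    (hv : LinearIndependent ℂ v) (i : Fin p) :
    crb (fisherInformation σ (colMatrix v)) i =
      σ ^ 2 * (‖(Submodule.span ℂ (v '' {i}ᶜ))ᗮ.starProjection (v i)‖ ^ 2)⁻¹ := by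
  have hdet : IsUnit (Matrix.gram ℂ v).det :=
    isUnit_iff_ne_zero.2 (Matrix.det_gram_ne_zero_iff_linearIndependent.2 hv)
  have h : (1 / (σ : ℂ) ^ 2) ≠ 0 := by simp [hσ.ne']
  rw [crb, fisherInformation_colMatrix, show (1 / (σ : ℂ) ^ 2) = (Units.mk0 _ h : ℂ) from rfl]
  rw [← Units.smul_def, Matrix.inv_smul' _ _ hdet, Matrix.smul_apply, inv_gram_apply_self hv]
  rw [Units.smul_def, Units.val_inv_eq_inv_val, Units.val_mk0, one_div, inv_inv, smul_eq_mul,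
    ← Complex.ofReal_pow, ← Complex.ofReal_mul, Complex.ofReal_re]

theorem crb_eq_zero_of_not_isUnit {J : Matrix (Fin p) (Fin p) ℂ} (hJ : ¬ IsUnit J) (i : Fin p) :
    crb J i = 0 := by
  rw [crb, Matrix.nonsing_inv_apply_not_isUnit _ (mt (Matrix.isUnit_iff_isUnit_det _).2 hJ)]
  simp

theorem conjTranspose_rowProjection (Φ : Matrix (Fin m) (Fin n) ℂ) :
    (rowProjection Φ)ᴴ = rowProjection Φ := by
  simp [rowProjection, Matrix.conjTranspose_mul, Matrix.conjTranspose_nonsing_inv, Matrix.mul_assoc]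

theorem mul_rowProjection {Φ : Matrix (Fin m) (Fin n) ℂ} (hΦ : IsUnit (Φ * Φᴴ)) :
    Φ * rowProjection Φ = Φ := by
  rw [rowProjection, ← Matrix.mul_assoc, ← Matrix.mul_assoc,
    Matrix.mul_nonsing_inv _ ((Matrix.isUnit_iff_isUnit_det _).1 hΦ), Matrix.one_mul]

theorem rowProjection_mul_self {Φ : Matrix (Fin m) (Fin n) ℂ} (hΦ : IsUnit (Φ * Φᴴ)) :
    rowProjection Φ * rowProjection Φ = rowProjection Φ := by
  nth_rw 1 [rowProjection]
  rw [Matrix.mul_assoc, mul_rowProjection hΦ, rowProjection]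

/-- A Hermitian idempotent is the orthogonal projection onto its range. -/
theorem toEuclideanLin_rowProjection {Φ : Matrix (Fin m) (Fin n) ℂ} (hΦ : IsUnit (Φ * Φᴴ)) :
    Matrix.toEuclideanLin (rowProjection Φ) = (rowSpace Φ).starProjection := by
  have h : (Matrix.toEuclideanLin (rowProjection Φ)).IsSymmetricProjection := by
    refine ⟨?_, ?_⟩
    · rw [IsIdempotentElem]
      ext1 x
      rw [Module.End.mul_apply, Matrix.toLpLin_apply, Matrix.toLpLin_apply,
        Matrix.mulVec_mulVec, rowProjection_mul_self hΦ]
    · exact Matrix.isSymmetric_toEuclideanLin_iff.2 (conjTranspose_rowProjection Φ)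
  obtain ⟨_, h2⟩ := LinearMap.isSymmetricProjection_iff_eq_coe_starProjection_range.1 h
  exact h2

theorem finrank_rowSpace {Φ : Matrix (Fin m) (Fin n) ℂ} (hΦ : IsUnit (Φ * Φᴴ)) :
    Module.finrank ℂ (rowSpace Φ) = m := by
  have h0 : Module.finrank ℂ (rowSpace Φ) = (rowProjection Φ).rank := by
    rw [rowSpace, Matrix.toEuclideanLin_eq_toLin_orthonormal, ← Matrix.rank_eq_finrank_range_toLin]
  rw [h0]
  apply le_antisymm
  · rw [rowProjection]
    exact (Matrix.rank_mul_le_right _ _).trans (Matrix.rank_le_height _)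
  · have h : Φ.rank = m := by
      have h1 : (Φ * Φᴴ).rank = m := by rw [Matrix.rank_of_isUnit _ hΦ, Fintype.card_fin]
      exact le_antisymm (Matrix.rank_le_height _) (h1.symm.le.trans (Matrix.rank_mul_le_left _ _))
    calc m = (Φ * rowProjection Φ).rank := by rw [mul_rowProjection hΦ, h]
      _ ≤ _ := Matrix.rank_mul_le_right _ _

theorem compressedFisherInformation_colMatrix (σ : ℝ) {Φ : Matrix (Fin m) (Fin n) ℂ}
    (hΦ : IsUnit (Φ * Φᴴ)) (v : Fin p → EuclideanSpace ℂ (Fin n)) :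
    compressedFisherInformation σ Φ (colMatrix v) =
      fisherInformation σ (colMatrix fun j => (rowSpace Φ).starProjection (v j)) := by
  rw [compressedFisherInformation, mul_colMatrix, toEuclideanLin_rowProjection hΦ]
  rfl

theorem isUnit_compressedFisherInformation_iff {σ : ℝ} (hσ : 0 < σ) {Φ : Matrix (Fin m) (Fin n) ℂ}
    (hΦ : IsUnit (Φ * Φᴴ)) (v : Fin p → EuclideanSpace ℂ (Fin n)) :
    IsUnit (compressedFisherInformation σ Φ (colMatrix v)) ↔
      LinearIndependent ℂ fun j => (rowSpace Φ).starProjection (v j) := by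
  rw [compressedFisherInformation_colMatrix σ hΦ, isUnit_fisherInformation_iff hσ]

/-- The part of the row space of `Φ` orthogonal to the projection of `W`. -/
noncomputable def residualSpace (Φ : Matrix (Fin m) (Fin n) ℂ)
    (W : Submodule ℂ (EuclideanSpace ℂ (Fin n))) : Submodule ℂ (EuclideanSpace ℂ (Fin n)) :=
  (W.map ((rowSpace Φ).starProjection : EuclideanSpace ℂ (Fin n) →ₗ[ℂ] _))ᗮ ⊓ rowSpace Φ

/-- Independence is required only of the other columns, so that `v i` can later range over all
vectors. If its projection is dependent on theirs, both sides vanish by the conventions for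
inverting a singular matrix and `0`. -/
theorem crb_compressedFisherInformation {σ : ℝ} (hσ : 0 < σ) {Φ : Matrix (Fin m) (Fin n) ℂ}
    (hΦ : IsUnit (Φ * Φᴴ)) {v : Fin p → EuclideanSpace ℂ (Fin n)} (i : Fin p)
    (hv : LinearIndepOn ℂ (fun j => (rowSpace Φ).starProjection (v j)) {i}ᶜ) :
    crb (compressedFisherInformation σ Φ (colMatrix v)) i =
      σ ^ 2 * (‖(residualSpace Φ (Submodule.span ℂ (v '' {i}ᶜ))).starProjection (v i)‖ ^ 2)⁻¹ := by
  have hmap : (Submodule.span ℂ (v '' {i}ᶜ)).map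
      ((rowSpace Φ).starProjection : EuclideanSpace ℂ (Fin n) →ₗ[ℂ] _) =
      Submodule.span ℂ ((fun j => (rowSpace Φ).starProjection (v j)) '' {i}ᶜ) := by
    rw [Submodule.map_span, Set.image_image]
    rfl
  by_cases h : LinearIndependent ℂ fun j => (rowSpace Φ).starProjection (v j)
  · rw [compressedFisherInformation_colMatrix σ hΦ, crb_fisherInformation hσ h, residualSpace,
      ← starProjection_orthogonal_map_starProjection]
    simp only [hmap]
  · rw [crb_eq_zero_of_not_isUnit (mt (isUnit_compressedFisherInformation_iff hσ hΦ v).1 h)]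
    have hmem : (rowSpace Φ).starProjection (v i) ∈
        Submodule.span ℂ ((fun j => (rowSpace Φ).starProjection (v j)) '' {i}ᶜ) := by
      by_contra hcon
      apply h
      rw [← linearIndepOn_univ_iff, ← Set.compl_union_self {i}, Set.union_comm, Set.singleton_union]
      exact hv.insert hcon
    rw [residualSpace, (starProjection_eq_zero_iff_mem_map _ _ _).2 (by rwa [hmap])]
    simp

theorem rowProjection_mul_unitary (Φ : Matrix (Fin m) (Fin n) ℂ) {U : Matrix (Fin n) (Fin n) ℂ}
    (hU : U ∈ Matrix.unitaryGroup (Fin n) ℂ) :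
    rowProjection (Φ * U) = Uᴴ * rowProjection Φ * U := by
  have h : U * Uᴴ = 1 := Matrix.mem_unitaryGroup_iff.1 hU
  have h1 : Φ * U * (Φ * U)ᴴ = Φ * Φᴴ := by
    rw [Matrix.conjTranspose_mul, Matrix.mul_assoc, ← Matrix.mul_assoc U, h, Matrix.one_mul]
  rw [rowProjection, h1, Matrix.conjTranspose_mul, rowProjection]
  simp only [Matrix.mul_assoc]

/-- The row projection is conjugated by `U`, and the outer factor `Uᴴ` drops out of the Gram matrix.
Rotating `Φ` is thus the same as rotating `G`. -/
theorem compressedFisherInformation_mul_unitary (σ : ℝ) (Φ : Matrix (Fin m) (Fin n) ℂ)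
    {U : Matrix (Fin n) (Fin n) ℂ} (hU : U ∈ Matrix.unitaryGroup (Fin n) ℂ)
    (G : Matrix (Fin n) (Fin p) ℂ) :
    compressedFisherInformation σ (Φ * U) G = compressedFisherInformation σ Φ (U * G) := by
  have h : U * Uᴴ = 1 := Matrix.mem_unitaryGroup_iff.1 hU
  have key : ∀ A : Matrix (Fin n) (Fin p) ℂ, (Uᴴ * A)ᴴ * (Uᴴ * A) = Aᴴ * A := fun A => by
    rw [Matrix.conjTranspose_mul, Matrix.conjTranspose_conjTranspose, Matrix.mul_assoc,
      ← Matrix.mul_assoc U, h, Matrix.one_mul]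
  rw [compressedFisherInformation, compressedFisherInformation, fisherInformation,
    fisherInformation, rowProjection_mul_unitary Φ hU, Matrix.mul_assoc, Matrix.mul_assoc, key]

/-- The matrix of a linear isometry of `ℂⁿ`. -/
noncomputable def isometryMatrix (U : EuclideanSpace ℂ (Fin n) ≃ₗᵢ[ℂ] EuclideanSpace ℂ (Fin n)) :
    Matrix (Fin n) (Fin n) ℂ :=
  Matrix.toEuclideanLin.symm (U.toLinearEquiv : EuclideanSpace ℂ (Fin n) →ₗ[ℂ] _)

theorem isometryMatrix_mul_colMatrix
    (U : EuclideanSpace ℂ (Fin n) ≃ₗᵢ[ℂ] EuclideanSpace ℂ (Fin n))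
    (v : Fin p → EuclideanSpace ℂ (Fin n)) :
    isometryMatrix U * colMatrix v = colMatrix fun j => U (v j) := by
  rw [mul_colMatrix, isometryMatrix, LinearEquiv.apply_symm_apply]
  rfl

theorem isometryMatrix_mem_unitaryGroup
    (U : EuclideanSpace ℂ (Fin n) ≃ₗᵢ[ℂ] EuclideanSpace ℂ (Fin n)) :
    isometryMatrix U ∈ Matrix.unitaryGroup (Fin n) ℂ := by
  set b : Fin n → EuclideanSpace ℂ (Fin n) := fun j => EuclideanSpace.single j 1 with hb
  have hb1 : colMatrix b = 1 := by
    ext i j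
    simp [colMatrix, hb, Matrix.one_apply]
  have h := isometryMatrix_mul_colMatrix U b
  rw [hb1, Matrix.mul_one] at h
  rw [Matrix.mem_unitaryGroup_iff', Matrix.star_eq_conjTranspose, h,
    conjTranspose_colMatrix_mul_colMatrix]
  have h2 : Matrix.gram ℂ (fun j => U (b j)) = Matrix.gram ℂ b := by
    ext i j
    simp [Matrix.gram_apply]
  rw [h2, ← conjTranspose_colMatrix_mul_colMatrix, hb1]
  simp

section Measurability

variable {α : Type*} [MeasurableSpace α] {ι κ l : Type*}

theorem measurable_mul_apply [Fintype κ] {A : α → Matrix ι κ ℂ} {B : α → Matrix κ l ℂ}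
    (hA : ∀ i j, Measurable fun a => A a i j) (hB : ∀ i j, Measurable fun a => B a i j) (i : ι)
    (j : l) : Measurable fun a => (A a * B a) i j := by
  simp only [Matrix.mul_apply]
  exact Finset.measurable_sum _ fun k _ => (hA i k).mul (hB k j)

theorem measurable_conjTranspose_apply {A : α → Matrix ι κ ℂ}
    (hA : ∀ i j, Measurable fun a => A a i j) (i : κ) (j : ι) :
    Measurable fun a => (A a)ᴴ i j := by
  simp only [Matrix.conjTranspose_apply]
  exact (Complex.continuous_conj.measurable).comp (hA j i)

theorem measurable_det [Fintype ι] [DecidableEq ι] {A : α → Matrix ι ι ℂ}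
    (hA : ∀ i j, Measurable fun a => A a i j) : Measurable fun a => (A a).det := by
  simp only [Matrix.det_apply']
  exact Finset.measurable_sum _ fun s _ =>
    (Finset.measurable_prod _ fun i _ => hA _ _).const_mul _

/-- By Cramer's rule an entry is a quotient of determinants, also at singular matrices, where it is
`0`. -/
theorem measurable_inv_apply [Fintype ι] [DecidableEq ι] {A : α → Matrix ι ι ℂ}
    (hA : ∀ i j, Measurable fun a => A a i j) (i j : ι) : Measurable fun a => (A a)⁻¹ i j := by
  simp only [Matrix.inv_def, Matrix.smul_apply, Ring.inverse_eq_inv', Matrix.adjugate_apply,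
    smul_eq_mul]
  refine (measurable_det hA).inv.mul (measurable_det fun k l => ?_)
  rcases eq_or_ne k j with rfl | h
  · simp
  · simpa [Matrix.updateRow_ne h] using hA k l

theorem measurable_compressedFisherInformation_apply (σ : ℝ) {Φ : α → Matrix (Fin m) (Fin n) ℂ}
    {v : α → Fin p → EuclideanSpace ℂ (Fin n)} (hΦ : ∀ i j, Measurable fun a => Φ a i j)
    (hv : ∀ j, Measurable fun a => v a j) (i j : Fin p) :
    Measurable fun a => compressedFisherInformation σ (Φ a) (colMatrix (v a)) i j := by
  have hP : ∀ i j, Measurable fun a => rowProjection (Φ a) i j := fun i j =>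
    measurable_mul_apply (measurable_mul_apply (measurable_conjTranspose_apply hΦ)
      (measurable_inv_apply (measurable_mul_apply hΦ (measurable_conjTranspose_apply hΦ)))) hΦ i j
  have hC : ∀ k j, Measurable fun a => colMatrix (v a) k j := fun k j => by
    have : Measurable fun x : EuclideanSpace ℂ (Fin n) => x k := by fun_prop
    exact this.comp (hv j)
  have hG : ∀ i j, Measurable fun a => (rowProjection (Φ a) * colMatrix (v a)) i j :=
    measurable_mul_apply hP hC
  simp only [compressedFisherInformation, fisherInformation, Matrix.smul_apply, smul_eq_mul]
  exact (measurable_mul_apply (measurable_conjTranspose_apply hG) hG i j).const_mul _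

theorem measurableSet_isUnit_compressedFisherInformation (σ : ℝ)
    {Φ : α → Matrix (Fin m) (Fin n) ℂ}
    {v : α → Fin p → EuclideanSpace ℂ (Fin n)} (hΦ : ∀ i j, Measurable fun a => Φ a i j)
    (hv : ∀ j, Measurable fun a => v a j) :
    MeasurableSet {a | IsUnit (compressedFisherInformation σ (Φ a) (colMatrix (v a)))} := by
  simp only [Matrix.isUnit_iff_isUnit_det, isUnit_iff_ne_zero]
  exact (measurable_det (measurable_compressedFisherInformation_apply σ hΦ hv)
    (measurableSet_singleton 0)).compl

theorem measurable_crb_compressedFisherInformation (σ : ℝ) {Φ : α → Matrix (Fin m) (Fin n) ℂ}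
    {v : α → Fin p → EuclideanSpace ℂ (Fin n)} (hΦ : ∀ i j, Measurable fun a => Φ a i j)
    (hv : ∀ j, Measurable fun a => v a j) (i : Fin p) :
    Measurable fun a => crb (compressedFisherInformation σ (Φ a) (colMatrix (v a))) i :=
  Complex.measurable_re.comp
    (measurable_inv_apply (measurable_compressedFisherInformation_apply σ hΦ hv) i i)

end Measurability

end Matrices

/-! ### Almost sure invertibility -/

section Averaging

variable {m n p : ℕ} {ν : Measure (Fin m → Fin n → ℂ)}

theorem measurable_of_apply {α : Type*} [MeasurableSpace α] {g : α → Fin m → Fin n → ℂ}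
    (hg : Measurable g) (i : Fin m) (j : Fin n) : Measurable fun a => Matrix.of (g a) i j := by
  change Measurable fun a => g a i j
  fun_prop

theorem lintegral_mul_unitary
    (hinv : ∀ U ∈ Matrix.unitaryGroup (Fin n) ℂ, ν.map (fun A k l => (Matrix.of A * U) k l) = ν)
    {f : Matrix (Fin m) (Fin n) ℂ → ℝ≥0∞} (hf : Measurable fun A => f (Matrix.of A))
    {U : Matrix (Fin n) (Fin n) ℂ} (hU : U ∈ Matrix.unitaryGroup (Fin n) ℂ) :
    ∫⁻ A, f (Matrix.of A * U) ∂ν = ∫⁻ A, f (Matrix.of A) ∂ν := by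
  have hmeas : Measurable fun (A : Fin m → Fin n → ℂ) k l => (Matrix.of A * U) k l := by
    refine measurable_pi_lambda _ fun k => measurable_pi_lambda _ fun l => ?_
    exact measurable_mul_apply (measurable_of_apply measurable_id')
      (B := fun _ => U) (fun i j => measurable_const) k l
  conv_rhs => rw [← hinv U hU, lintegral_map hf hmeas]
  rfl

theorem residualSpace_starProjection_add (Φ : Matrix (Fin m) (Fin n) ℂ)
    (W : Submodule ℂ (EuclideanSpace ℂ (Fin n))) (x : EuclideanSpace ℂ (Fin n))
    {w : EuclideanSpace ℂ (Fin n)} (hw : w ∈ W) :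
    (residualSpace Φ W).starProjection (x + w) = (residualSpace Φ W).starProjection x := by
  rw [map_add, residualSpace, starProjection_orthogonal_map_inf_eq_zero _ _ hw, add_zero]

theorem isUnit_compressedFisherInformation_snoc_iff {σ : ℝ} (hσ : 0 < σ)
    {Φ : Matrix (Fin m) (Fin n) ℂ} (hΦ : IsUnit (Φ * Φᴴ)) {v : Fin p → EuclideanSpace ℂ (Fin n)}
    (hv : LinearIndependent ℂ fun j => (rowSpace Φ).starProjection (v j))
    (x : EuclideanSpace ℂ (Fin n)) :
    IsUnit (compressedFisherInformation σ Φ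
        (colMatrix (Fin.snoc v x : Fin (p + 1) → EuclideanSpace ℂ (Fin n)))) ↔
      (residualSpace Φ (Submodule.span ℂ (Set.range v))).starProjection x ≠ 0 := by
  have h : (fun j => (rowSpace Φ).starProjection
      ((Fin.snoc v x : Fin (p + 1) → EuclideanSpace ℂ (Fin n)) j)) =
      Fin.snoc (fun j => (rowSpace Φ).starProjection (v j)) ((rowSpace Φ).starProjection x) := by
    ext1 j
    refine Fin.lastCases ?_ (fun j => ?_) j <;> simp
  rw [isUnit_compressedFisherInformation_iff hσ hΦ, h, linearIndependent_finSnoc,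
    and_iff_right hv, residualSpace, Ne, starProjection_eq_zero_iff_mem_map, Submodule.map_span,
    ← Set.range_comp]
  rfl

/-- Induction on the number of columns. With the earlier columns fixed, the probability that a new
column `y` degenerates is constant off their span `W`; by Fubini it is zero for almost every `y`,
hence for every `y` off `W`. -/
theorem ae_isUnit_compressedFisherInformation [IsProbabilityMeasure ν]
    (hinv : ∀ U ∈ Matrix.unitaryGroup (Fin n) ℂ, ν.map (fun A k l => (Matrix.of A * U) k l) = ν)
    (hrank : ∀ᵐ A ∂ν, IsUnit (Matrix.of A * (Matrix.of A)ᴴ)) {σ : ℝ} (hσ : 0 < σ) (q : ℕ)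
    (hq : q ≤ m) (v : Fin q → EuclideanSpace ℂ (Fin n)) (hv : LinearIndependent ℂ v) :
    ∀ᵐ A ∂ν, IsUnit (compressedFisherInformation σ (Matrix.of A) (colMatrix v)) := by
  induction q with
  | zero =>
    filter_upwards [hrank] with A hA
    rw [isUnit_compressedFisherInformation_iff hσ hA]
    exact linearIndependent_empty_type
  | succ q ih =>
    obtain ⟨w, x, rfl⟩ : ∃ (w : Fin q → EuclideanSpace ℂ (Fin n)) (x : EuclideanSpace ℂ (Fin n)),
        v = Fin.snoc w x := ⟨Fin.init v, v (Fin.last q), (Fin.snoc_init_self v).symm⟩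
    obtain ⟨hw, hx⟩ := linearIndependent_finSnoc.1 hv
    have hgood : ∀ᵐ A ∂ν, IsUnit (Matrix.of A * (Matrix.of A)ᴴ) ∧
        LinearIndependent ℂ fun j => (rowSpace (Matrix.of A)).starProjection (w j) := by
      filter_upwards [hrank, ih (by omega) w hw] with A hA hA'
      exact ⟨hA, (isUnit_compressedFisherInformation_iff hσ hA w).1 hA'⟩
    set W := Submodule.span ℂ (Set.range w) with hW
    have hsnoc : ∀ j, Measurable fun y : EuclideanSpace ℂ (Fin n) =>
        (Fin.snoc w y : Fin (q + 1) → EuclideanSpace ℂ (Fin n)) j := fun j => by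
      refine Fin.lastCases ?_ (fun j => ?_) j
      · simpa using measurable_id'
      · simp
    -- The probability of degeneracy, written as an integral so that `lintegral_mul_unitary`
    -- applies.
    set f : EuclideanSpace ℂ (Fin n) → ℝ≥0∞ := fun y =>
      ∫⁻ A, {Φ : Matrix (Fin m) (Fin n) ℂ | ¬ IsUnit (compressedFisherInformation σ Φ
        (colMatrix (Fin.snoc w y : Fin (q + 1) → EuclideanSpace ℂ (Fin n))))}.indicator 1
        (Matrix.of A) ∂ν with hf
    have hmeas : ∀ y, MeasurableSet {A : Fin m → Fin n → ℂ |
        ¬ IsUnit (compressedFisherInformation σ (Matrix.of A)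
        (colMatrix (Fin.snoc w y : Fin (q + 1) → EuclideanSpace ℂ (Fin n))))} := fun y => by
      have h := measurableSet_isUnit_compressedFisherInformation (α := Fin m → Fin n → ℂ) σ
        (v := fun _ => (Fin.snoc w y : Fin (q + 1) → EuclideanSpace ℂ (Fin n)))
        (measurable_of_apply measurable_id') (fun _ => measurable_const)
      exact h.compl
    have hf1 : ∀ y, f y = ν {A | (residualSpace (Matrix.of A) W).starProjection y = 0} := by
      intro y
      have : f y = ν {A | ¬ IsUnit (compressedFisherInformation σ (Matrix.of A)
          (colMatrix (Fin.snoc w y : Fin (q + 1) → EuclideanSpace ℂ (Fin n))))} := by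
        rw [← lintegral_indicator_one (hmeas y)]
        rfl
      rw [this]
      refine measure_congr ?_
      filter_upwards [hgood] with A hA
      exact propext (by
        have := isUnit_compressedFisherInformation_snoc_iff hσ hA.1 hA.2 y
        change ¬ _ ↔ _
        rw [this, not_not]
        rfl)
    have hfU : ∀ U : EuclideanSpace ℂ (Fin n) ≃ₗᵢ[ℂ] EuclideanSpace ℂ (Fin n),
        (∀ z ∈ W, U z = z) → ∀ y, f (U y) = f y := by
      intro U hU y
      have hs : (Fin.snoc w (U y) : Fin (q + 1) → EuclideanSpace ℂ (Fin n)) =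
          fun j => U ((Fin.snoc w y : Fin (q + 1) → EuclideanSpace ℂ (Fin n)) j) := by
        ext1 j
        refine Fin.lastCases ?_ (fun j => ?_) j
        · simp
        · simpa using (hU _ (Submodule.subset_span ⟨j, rfl⟩)).symm
      have hmi : Measurable fun A : Fin m → Fin n → ℂ => {Φ : Matrix (Fin m) (Fin n) ℂ |
          ¬ IsUnit (compressedFisherInformation σ Φ
          (colMatrix (Fin.snoc w y : Fin (q + 1) → EuclideanSpace ℂ (Fin n))))}.indicator
          (1 : Matrix (Fin m) (Fin n) ℂ → ℝ≥0∞) (Matrix.of A) :=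
        measurable_one.indicator (hmeas y)
      simp only [hf]
      rw [← lintegral_mul_unitary hinv hmi (isometryMatrix_mem_unitaryGroup U)]
      refine lintegral_congr fun A => ?_
      refine Set.indicator_eq_indicator ?_ rfl
      change ¬ IsUnit _ ↔ ¬ IsUnit _
      rw [compressedFisherInformation_mul_unitary _ _ (isometryMatrix_mem_unitaryGroup U),
        isometryMatrix_mul_colMatrix, hs]
    have hconst : ∀ y, y ∉ W → f y = f x := fun y hy => by
      refine eq_of_invariant_of_notMem W f hfU (fun y z hz => ?_) (fun c y hc => ?_) hy hx
      · simp only [hf1, residualSpace_starProjection_add _ _ _ hz]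
      · simp only [hf1, map_smul, smul_eq_zero, hc, false_or]
    have hae : ∀ᵐ y : EuclideanSpace ℂ (Fin n), ∀ᵐ A ∂ν,
        IsUnit (compressedFisherInformation σ (Matrix.of A)
          (colMatrix (Fin.snoc w y : Fin (q + 1) → EuclideanSpace ℂ (Fin n)))) := by
      rw [Measure.ae_ae_comm]
      · filter_upwards [hgood] with A hA
        -- Its dimension is `m - q`, positive because `q + 1 ≤ m`.
        have hne : residualSpace (Matrix.of A) W ≠ ⊥ := by
          intro h
          have h1 := finrank_orthogonal_inf_map_span (rowSpace (Matrix.of A)) hA.2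
          rw [finrank_rowSpace hA.1] at h1
          rw [residualSpace] at h
          rw [← hW, h, Fintype.card_fin, finrank_bot] at h1
          omega
        filter_upwards [ae_starProjection_ne_zero volume hne] with y hy
        exact (isUnit_compressedFisherInformation_snoc_iff hσ hA.1 hA.2 y).2 hy
      · exact measurableSet_isUnit_compressedFisherInformation σ
          (measurable_of_apply measurable_snd) (fun j => (hsnoc j).comp measurable_fst)
    have hWne : Wᗮ ≠ ⊥ := fun h => by
      rw [Submodule.orthogonal_eq_bot_iff] at h
      exact hx (h ▸ Submodule.mem_top)
    obtain ⟨y, hy1, hy2⟩ := (hae.and (ae_starProjection_ne_zero volume hWne)).exists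
    have hyW : y ∉ W := fun h => hy2 (Submodule.starProjection_orthogonal_apply_eq_zero h)
    have hfx : f x = 0 := by
      rw [← hconst y hyW, hf]
      refine (lintegral_congr_ae ?_).trans lintegral_zero
      filter_upwards [hy1] with A hA
      simp [hA]
    rw [ae_iff, ← lintegral_indicator_one (hmeas x)]
    exact hfx

end Averaging

/-! ### Moments of the compressed bound -/

section Moments

variable {m n p : ℕ} {ν : Measure (Fin m → Fin n → ℂ)}

theorem norm_starProjection_orthogonal_isometry {E : Type*} [NormedAddCommGroup E]
    [InnerProductSpace ℂ E] [FiniteDimensional ℂ E] {W : Submodule ℂ E} {U : E ≃ₗᵢ[ℂ] E}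
    (hU : ∀ w ∈ W, U w = w) (x : E) :
    ‖Wᗮ.starProjection (U x)‖ = ‖Wᗮ.starProjection x‖ := by
  have h1 : U x = W.starProjection x + U (Wᗮ.starProjection x) := by
    conv_lhs => rw [← Submodule.starProjection_add_starProjection_orthogonal (K := W) x, map_add,
      hU _ (Submodule.starProjection_apply_mem _ _)]
  have h2 : U (Wᗮ.starProjection x) ∈ Wᗮ := by
    rw [Submodule.mem_orthogonal]
    intro w hw
    conv_lhs => rw [← hU w hw, U.inner_map_map]
    exact Submodule.starProjection_apply_mem Wᗮ x w hw
  rw [h1, map_add, Submodule.starProjection_orthogonal_apply_eq_zero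
    (Submodule.starProjection_apply_mem _ _), zero_add, Submodule.starProjection_eq_self_iff.2 h2,
    U.norm_map]

theorem span_image_compl_eq {E : Type*} [AddCommGroup E] [Module ℂ E] (v : Fin p → E) (i : Fin p) :
    Submodule.span ℂ (v '' {i}ᶜ) =
      Submodule.span ℂ (Set.range fun j : ({i}ᶜ : Set (Fin p)) => v j) := by
  rw [Set.image_eq_range]

theorem card_compl_singleton_add_one (i : Fin p) :
    Fintype.card ({i}ᶜ : Set (Fin p)) + 1 = p := by
  have := i.pos
  rw [Fintype.card_compl_set, Fintype.card_fin, Fintype.card_unique]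
  omega

theorem finrank_residualSpace {Φ : Matrix (Fin m) (Fin n) ℂ} (hΦ : IsUnit (Φ * Φᴴ))
    {v : Fin p → EuclideanSpace ℂ (Fin n)}
    (hv : LinearIndependent ℂ fun j => (rowSpace Φ).starProjection (v j)) (i : Fin p) :
    (Module.finrank ℂ (residualSpace Φ (Submodule.span ℂ (v '' {i}ᶜ))) : ℝ) = m - p + 1 := by
  have h := finrank_orthogonal_inf_map_span (rowSpace Φ)
    (v := fun j : ({i}ᶜ : Set (Fin p)) => v j) (hv.comp _ Subtype.val_injective)
  rw [finrank_rowSpace hΦ, ← span_image_compl_eq] at h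
  have h1 := card_compl_singleton_add_one i
  rw [residualSpace]
  have h2 : (Fintype.card ({i}ᶜ : Set (Fin p)) : ℝ) + 1 = p := by exact_mod_cast h1
  have h3 := congrArg (Nat.cast (R := ℝ)) h
  push_cast at h3
  linarith

theorem finrank_orthogonal_span_compl {v : Fin p → EuclideanSpace ℂ (Fin n)}
    (hv : LinearIndependent ℂ v) (i : Fin p) :
    (Module.finrank ℂ (Submodule.span ℂ (v '' {i}ᶜ))ᗮ : ℝ) = n - p + 1 := by
  have h := Submodule.finrank_add_finrank_orthogonal (Submodule.span ℂ (v '' {i}ᶜ))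
  have h0 : Module.finrank ℂ (Submodule.span ℂ (v '' {i}ᶜ)) =
      Fintype.card ({i}ᶜ : Set (Fin p)) := by
    rw [span_image_compl_eq]
    exact finrank_span_eq_card (hv.comp _ Subtype.val_injective)
  rw [h0, finrank_euclideanSpace_fin] at h
  have h1 := card_compl_singleton_add_one i
  have h2 : (Fintype.card ({i}ᶜ : Set (Fin p)) : ℝ) + 1 = p := by exact_mod_cast h1
  have h3 := congrArg (Nat.cast (R := ℝ)) h
  push_cast at h3
  linarith

theorem lintegral_crb_rpow_isometry
    (hinv : ∀ U ∈ Matrix.unitaryGroup (Fin n) ℂ, ν.map (fun A k l => (Matrix.of A * U) k l) = ν)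
    (σ : ℝ) (U : EuclideanSpace ℂ (Fin n) ≃ₗᵢ[ℂ] EuclideanSpace ℂ (Fin n))
    (v : Fin p → EuclideanSpace ℂ (Fin n)) (i : Fin p) (s : ℝ) :
    ∫⁻ A, ENNReal.ofReal (crb (compressedFisherInformation σ (Matrix.of A)
        (colMatrix fun j => U (v j))) i ^ s) ∂ν =
      ∫⁻ A, ENNReal.ofReal (crb (compressedFisherInformation σ (Matrix.of A)
        (colMatrix v)) i ^ s) ∂ν := by
  have h := measurable_crb_compressedFisherInformation (α := Fin m → Fin n → ℂ) σ
    (Φ := fun A => Matrix.of A) (v := fun _ => v) (measurable_of_apply measurable_id')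
    (fun _ => measurable_const) i
  have hm : Measurable fun A : Fin m → Fin n → ℂ => ENNReal.ofReal
      (crb (compressedFisherInformation σ (Matrix.of A) (colMatrix v)) i ^ s) :=
    (h.pow_const s).ennreal_ofReal
  rw [← lintegral_mul_unitary (f := fun Φ => ENNReal.ofReal
    (crb (compressedFisherInformation σ Φ (colMatrix v)) i ^ s)) hinv hm
    (isometryMatrix_mem_unitaryGroup U)]
  refine lintegral_congr fun A => ?_
  rw [compressedFisherInformation_mul_unitary _ _ (isometryMatrix_mem_unitaryGroup U),
    isometryMatrix_mul_colMatrix]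

set_option maxHeartbeats 800000 in
/-- The moment of order `s` of the Cramér-Rao bound after a right-unitarily invariant
compression. -/
theorem lintegral_crb_rpow [IsProbabilityMeasure ν]
    (hinv : ∀ U ∈ Matrix.unitaryGroup (Fin n) ℂ, ν.map (fun A k l => (Matrix.of A * U) k l) = ν)
    (hrank : ∀ᵐ A ∂ν, IsUnit (Matrix.of A * (Matrix.of A)ᴴ)) {σ : ℝ} (hσ : 0 < σ)
    (hpm : p ≤ m) (hmn : m ≤ n) {v : Fin p → EuclideanSpace ℂ (Fin n)}
    (hv : LinearIndependent ℂ v) (i : Fin p) {s : ℝ} (hs : 0 < s) (hsm : s < m - p + 1) :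
    ∫⁻ A, ENNReal.ofReal
        (crb (compressedFisherInformation σ (Matrix.of A) (colMatrix v)) i ^ s) ∂ν =
      ENNReal.ofReal (crb (fisherInformation σ (colMatrix v)) i ^ s *
        ((Real.Gamma (m - p + 1 - s) / Real.Gamma (m - p + 1)) /
          (Real.Gamma (n - p + 1 - s) / Real.Gamma (n - p + 1)))) := by
  have hmn' : (m : ℝ) ≤ n := by exact_mod_cast hmn
  have hsn : s < n - p + 1 := by linarith
  set W := Submodule.span ℂ (v '' {i}ᶜ) with hW
  have hgood : ∀ᵐ A ∂ν, IsUnit (Matrix.of A * (Matrix.of A)ᴴ) ∧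
      LinearIndependent ℂ fun j => (rowSpace (Matrix.of A)).starProjection (v j) := by
    filter_upwards [hrank, ae_isUnit_compressedFisherInformation hinv hrank hσ p hpm v hv]
      with A hA hA'
    exact ⟨hA, (isUnit_compressedFisherInformation_iff hσ hA v).1 hA'⟩
  have hviW : v i ∉ W := hv.notMem_span_image (by simp)
  have hupd : ∀ y, (Function.update v i y) '' {i}ᶜ = v '' {i}ᶜ := fun y => by
    refine Set.image_congr fun j hj => ?_
    exact Function.update_of_ne hj _ _
  -- The exceptional null set does not depend on `y`; this allows integrating over `y` for fixed
  -- `A`.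
  have hcrb' : ∀ᵐ A ∂ν, ∀ y,
      crb (compressedFisherInformation σ (Matrix.of A) (colMatrix (Function.update v i y))) i =
        σ ^ 2 * (‖(residualSpace (Matrix.of A) W).starProjection y‖ ^ 2)⁻¹ := by
    filter_upwards [hgood] with A hA y
    rw [crb_compressedFisherInformation hσ hA.1]
    · simp only [hupd, Function.update_self, hW]
    · refine (linearIndepOn_congr fun j hj => ?_).1 (hA.2.linearIndepOn (s := {i}ᶜ))
      rw [Function.update_of_ne hj]
  have hcrb := fun y => hcrb'.mono fun A hA => hA y
  set F : EuclideanSpace ℂ (Fin n) → ℝ≥0∞ := fun y => ∫⁻ A, ENNReal.ofReal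
    (crb (compressedFisherInformation σ (Matrix.of A) (colMatrix (Function.update v i y))) i ^ s) ∂ν
    with hF
  have hupdm : ∀ j, Measurable fun y : EuclideanSpace ℂ (Fin n) => Function.update v i y j :=
    fun j => by
      rcases eq_or_ne j i with rfl | hj
      · simpa using measurable_id'
      · simp [Function.update_of_ne hj]
  have hmeas : Measurable fun z : EuclideanSpace ℂ (Fin n) × (Fin m → Fin n → ℂ) =>
      ENNReal.ofReal (crb (compressedFisherInformation σ (Matrix.of z.2)
        (colMatrix (Function.update v i z.1))) i ^ s) :=
    ((measurable_crb_compressedFisherInformation σ (measurable_of_apply measurable_snd)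
      (fun j => (hupdm j).comp measurable_fst) i).pow_const s).ennreal_ofReal
  -- The factor compensates the homogeneity of `F` in `y`, which makes `H` scale invariant.
  set H : EuclideanSpace ℂ (Fin n) → ℝ≥0∞ := fun y =>
    F y * ENNReal.ofReal ((‖Wᗮ.starProjection y‖ ^ 2) ^ s) with hH
  have hH1 : ∀ y, H y = ∫⁻ A, ENNReal.ofReal ((σ ^ 2 *
      (‖(residualSpace (Matrix.of A) W).starProjection y‖ ^ 2)⁻¹ *
        ‖Wᗮ.starProjection y‖ ^ 2) ^ s) ∂ν := fun y => by
    simp only [hH, hF]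
    rw [← lintegral_mul_const' _ _ ENNReal.ofReal_ne_top]
    refine lintegral_congr_ae ?_
    filter_upwards [hcrb y] with A hA
    rw [hA, ← ENNReal.ofReal_mul (by positivity),
      ← Real.mul_rpow (by positivity) (by positivity)]
  have hHU : ∀ U : EuclideanSpace ℂ (Fin n) ≃ₗᵢ[ℂ] EuclideanSpace ℂ (Fin n),
      (∀ z ∈ W, U z = z) → ∀ y, H (U y) = H y := by
    intro U hU y
    have hs : Function.update v i (U y) = fun j => U (Function.update v i y j) := by
      ext1 j
      rcases eq_or_ne j i with rfl | hj
      · simp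
      · rw [Function.update_of_ne hj, Function.update_of_ne hj,
          hU _ (Submodule.subset_span ⟨j, hj, rfl⟩)]
    have hFU : F (U y) = F y := by
      simp only [hF, hs]
      exact lintegral_crb_rpow_isometry hinv σ U _ i s
    simp only [hH, hFU, norm_starProjection_orthogonal_isometry hU]
  have hconst : ∀ y, y ∉ W → H y = H (v i) := fun y hy => by
    refine eq_of_invariant_of_notMem W H hHU (fun y z hz => ?_) (fun c y hc => ?_) hy hviW
    · simp only [hH1, residualSpace_starProjection_add _ _ _ hz, map_add,
        Submodule.starProjection_orthogonal_apply_eq_zero hz, add_zero]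
    · simp only [hH1]
      refine lintegral_congr fun A => ?_
      have hc' : ‖c‖ ^ 2 ≠ 0 := by simpa using hc
      rw [map_smul, map_smul, norm_smul, norm_smul, mul_pow, mul_pow, mul_inv]
      congr 2
      field_simp
  have hne : ∀ y, y ∉ W → ‖Wᗮ.starProjection y‖ ^ 2 ≠ 0 := fun y hy h => by
    rw [sq_eq_zero_iff, norm_eq_zero, Submodule.starProjection_apply_eq_zero_iff,
      Submodule.orthogonal_orthogonal] at h
    exact hy h
  have hFH : ∀ y, y ∉ W →
      F y = H (v i) * ENNReal.ofReal (((‖Wᗮ.starProjection y‖ ^ 2)⁻¹) ^ s) := fun y hy => by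
    have h0 : 0 < ‖Wᗮ.starProjection y‖ ^ 2 := lt_of_le_of_ne (by positivity) (hne y hy).symm
    rw [← hconst y hy, hH]
    simp only
    rw [mul_assoc, ← ENNReal.ofReal_mul (by positivity),
      ← Real.mul_rpow (by positivity) (by positivity), mul_inv_cancel₀ h0.ne', Real.one_rpow,
      ENNReal.ofReal_one, mul_one]
  set Z := ∫⁻ y : EuclideanSpace ℂ (Fin n), ENNReal.ofReal (Real.exp (-‖y‖ ^ 2)) with hZ
  have hZ0 : Z ≠ 0 := lintegral_exp_neg_norm_sq_ne_zero _
  have hZtop : Z ≠ ∞ := lintegral_exp_neg_norm_sq_ne_top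
  have hWne : Wᗮ ≠ ⊥ := fun h => by
    rw [Submodule.orthogonal_eq_bot_iff] at h
    exact hviW (h ▸ Submodule.mem_top)
  -- First evaluation of the Gaussian average of `F`: off `W`, `F` is a constant times a negative
  -- power of `‖P_{Wᗮ} y‖²`.
  have hI1 : ∫⁻ y : EuclideanSpace ℂ (Fin n), ENNReal.ofReal (Real.exp (-‖y‖ ^ 2)) * F y =
      H (v i) * (ENNReal.ofReal (Real.Gamma (n - p + 1 - s) / Real.Gamma (n - p + 1)) * Z) := by
    rw [← finrank_orthogonal_span_compl hv i, hZ, ← lintegral_exp_mul_rpow_neg volume _ hs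
      (by rw [finrank_orthogonal_span_compl hv i]; exact hsn), ← lintegral_const_mul _ (by fun_prop)]
    refine lintegral_congr_ae ?_
    filter_upwards [ae_starProjection_ne_zero volume hWne] with y hy
    rw [hFH y fun h => hy (Submodule.starProjection_orthogonal_apply_eq_zero h), mul_left_comm]
  -- Second evaluation: for fixed `A` the integral over `y` depends only on the dimension of the
  -- residual space, so the integral over `A` is trivial.
  have hI2 : ∫⁻ y : EuclideanSpace ℂ (Fin n), ENNReal.ofReal (Real.exp (-‖y‖ ^ 2)) * F y =
      ENNReal.ofReal ((σ ^ 2) ^ s) *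
        (ENNReal.ofReal (Real.Gamma (m - p + 1 - s) / Real.Gamma (m - p + 1)) * Z) := by
    have h1 : ∀ y : EuclideanSpace ℂ (Fin n), ENNReal.ofReal (Real.exp (-‖y‖ ^ 2)) * F y =
        ∫⁻ A, ENNReal.ofReal (Real.exp (-‖y‖ ^ 2)) * ENNReal.ofReal
          (crb (compressedFisherInformation σ (Matrix.of A)
            (colMatrix (Function.update v i y))) i ^ s) ∂ν := fun y => by
      rw [lintegral_const_mul' _ _ ENNReal.ofReal_ne_top]
    have hexp : Measurable fun y : EuclideanSpace ℂ (Fin n) =>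
      ENNReal.ofReal (Real.exp (-‖y‖ ^ 2)) := by fun_prop
    rw [lintegral_congr h1, lintegral_lintegral_swap
      ((hexp.comp measurable_fst).mul hmeas).aemeasurable]
    have h3 : ∀ᵐ A ∂ν, ∫⁻ y : EuclideanSpace ℂ (Fin n), ENNReal.ofReal (Real.exp (-‖y‖ ^ 2)) *
        ENNReal.ofReal (crb (compressedFisherInformation σ (Matrix.of A)
            (colMatrix (Function.update v i y))) i ^ s) = ENNReal.ofReal ((σ ^ 2) ^ s) *
        (ENNReal.ofReal (Real.Gamma (m - p + 1 - s) / Real.Gamma (m - p + 1)) * Z) := by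
      filter_upwards [hgood, hcrb'] with A hA hA2
      rw [← finrank_residualSpace hA.1 hA.2 i, hZ, ← lintegral_exp_mul_rpow_neg volume _ hs
        (by rw [finrank_residualSpace hA.1 hA.2 i]; exact hsm),
        ← lintegral_const_mul _ (by fun_prop)]
      refine lintegral_congr fun y => ?_
      rw [hA2 y, Real.mul_rpow (by positivity) (by positivity), ENNReal.ofReal_mul (by positivity),
        mul_left_comm]
    rw [lintegral_congr_ae h3, lintegral_const, measure_univ, mul_one]
  have hΓ1 := Real.Gamma_pos_of_pos (hs.trans hsn)
  have hΓ2 := Real.Gamma_pos_of_pos (sub_pos.2 hsn)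
  have hΓ3 := Real.Gamma_pos_of_pos (hs.trans hsm)
  have hΓ4 := Real.Gamma_pos_of_pos (sub_pos.2 hsm)
  set cn := Real.Gamma (n - p + 1 - s) / Real.Gamma (n - p + 1) with hcn
  set cm := Real.Gamma (m - p + 1 - s) / Real.Gamma (m - p + 1) with hcm
  have hcn0 : 0 < cn := by positivity
  have hcm0 : 0 < cm := by positivity
  have hHv : H (v i) = ENNReal.ofReal ((σ ^ 2) ^ s * (cm / cn)) := by
    have h := hI1.symm.trans hI2
    rw [← mul_assoc, ← mul_assoc, ENNReal.mul_left_inj hZ0 hZtop,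
      ← ENNReal.ofReal_mul (by positivity)] at h
    have h0 : ENNReal.ofReal cn ≠ 0 := by simpa using hcn0
    rw [← ENNReal.mul_left_inj h0 ENNReal.ofReal_ne_top, h, ← ENNReal.ofReal_mul (by positivity)]
    congr 1
    field_simp
  have hFv := hFH (v i) hviW
  simp only [hF, Function.update_eq_self] at hFv
  rw [hFv, hHv, ← ENNReal.ofReal_mul (by positivity), crb_fisherInformation hσ hv,
    Real.mul_rpow (by positivity) (by positivity)]
  congr 1
  ring

end Moments

/-! ### Positivity, integrability and Gamma quotients -/

section Moments

variable {m n p : ℕ} {ν : Measure (Fin m → Fin n → ℂ)}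

theorem crb_fisherInformation_nonneg {σ : ℝ} (hσ : 0 < σ) (v : Fin p → EuclideanSpace ℂ (Fin n))
    (i : Fin p) : 0 ≤ crb (fisherInformation σ (colMatrix v)) i := by
  by_cases hv : LinearIndependent ℂ v
  · rw [crb_fisherInformation hσ hv]
    positivity
  · rw [crb_eq_zero_of_not_isUnit (mt (isUnit_fisherInformation_iff hσ v).1 hv)]

theorem crb_compressedFisherInformation_nonneg {σ : ℝ} (hσ : 0 < σ) (Φ : Matrix (Fin m) (Fin n) ℂ)
    (v : Fin p → EuclideanSpace ℂ (Fin n)) (i : Fin p) :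
    0 ≤ crb (compressedFisherInformation σ Φ (colMatrix v)) i := by
  rw [compressedFisherInformation, mul_colMatrix]
  exact crb_fisherInformation_nonneg hσ _ _

/-- A nonnegative function whose `lintegral` is finite is integrable, with the same integral. -/
theorem integrable_and_integral_eq_of_lintegral {α : Type*} [MeasurableSpace α] {μ : Measure α}
    {f : α → ℝ} (hf : AEStronglyMeasurable f μ) (hf0 : ∀ a, 0 ≤ f a) {c : ℝ} (hc : 0 ≤ c)
    (h : ∫⁻ a, ENNReal.ofReal (f a) ∂μ = ENNReal.ofReal c) :
    Integrable f μ ∧ ∫ a, f a ∂μ = c := by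
  refine ⟨⟨hf, ?_⟩, ?_⟩
  · rw [hasFiniteIntegral_iff_ofReal (Filter.Eventually.of_forall hf0), h]
    exact ENNReal.ofReal_lt_top
  · rw [integral_eq_lintegral_of_nonneg_ae (Filter.Eventually.of_forall hf0) hf, h,
      ENNReal.toReal_ofReal hc]

theorem Gamma_sub_one_div_Gamma {x : ℝ} (hx : 1 < x) :
    Real.Gamma (x - 1) / Real.Gamma x = 1 / (x - 1) := by
  have h := Real.Gamma_add_one (sub_ne_zero.2 hx.ne')
  have hpos := Real.Gamma_pos_of_pos (sub_pos.2 hx)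
  have hx1 : x - 1 ≠ 0 := sub_ne_zero.2 hx.ne'
  rw [sub_add_cancel] at h
  rw [h]
  field_simp

theorem Gamma_sub_two_div_Gamma {x : ℝ} (hx : 2 < x) :
    Real.Gamma (x - 2) / Real.Gamma x = 1 / ((x - 1) * (x - 2)) := by
  have h1 := Gamma_sub_one_div_Gamma (show 1 < x by linarith)
  have h2 := Gamma_sub_one_div_Gamma (show 1 < x - 1 by linarith)
  rw [show x - 1 - 1 = x - 2 by ring] at h2
  have hpos := Real.Gamma_pos_of_pos (show 0 < x - 1 by linarith)
  rw [← div_mul_div_cancel₀ hpos.ne', h1, h2, div_mul_div_comm, one_mul, mul_comm (x - 2)]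

end Moments

end CompressedCRB

/-! ### Mean and variance -/

theorem mainTheorem7 {Ω : Type*} [MeasurableSpace Ω] (μ : Measure Ω) [IsProbabilityMeasure μ]
    (m n p : ℕ) (hmn : m + p ≤ n)
    (x : (Fin p → ℝ) → (Fin n → ℂ)) (θ : Fin p → ℝ)
    (hx : ∀ i : Fin p, LineDifferentiableAt ℝ x θ (Pi.single i 1))
    (σ : ℝ) (hσ : 0 < σ)
    (hJ : IsUnit (CompressedCRB.fisherInformation σ (CompressedCRB.sensitivityMatrix x θ)))
    (Φ : Ω → Matrix (Fin m) (Fin n) ℂ)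
    (hΦ : CompressedCRB.IsRightUnitarilyInvariant μ Φ)
    (hΦ_rank : ∀ᵐ ω ∂μ, IsUnit (Φ ω * (Φ ω)ᴴ))
    (i : Fin p) :
    (p < m →
      (∀ᵐ ω ∂μ, IsUnit (CompressedCRB.compressedFisherInformation σ (Φ ω)
        (CompressedCRB.sensitivityMatrix x θ))) ∧
      Integrable (fun ω => CompressedCRB.crb (CompressedCRB.compressedFisherInformation σ (Φ ω)
        (CompressedCRB.sensitivityMatrix x θ)) i) μ ∧
      ∫ ω, CompressedCRB.crb (CompressedCRB.compressedFisherInformation σ (Φ ω)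
        (CompressedCRB.sensitivityMatrix x θ)) i ∂μ =
        (((n : ℝ) - p) / ((m : ℝ) - p)) *
          CompressedCRB.crb
            (CompressedCRB.fisherInformation σ (CompressedCRB.sensitivityMatrix x θ)) i) ∧
    (p + 1 < m →
      MemLp (fun ω => CompressedCRB.crb (CompressedCRB.compressedFisherInformation σ (Φ ω)
        (CompressedCRB.sensitivityMatrix x θ)) i) 2 μ ∧
      variance (fun ω => CompressedCRB.crb (CompressedCRB.compressedFisherInformation σ (Φ ω)
        (CompressedCRB.sensitivityMatrix x θ)) i) μ =
        (((n : ℝ) - m) * ((n : ℝ) - p) / (((m : ℝ) - p - 1) * ((m : ℝ) - p) ^ 2)) *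
          (CompressedCRB.crb
            (CompressedCRB.fisherInformation σ (CompressedCRB.sensitivityMatrix x θ)) i) ^ 2) := by
  obtain ⟨v, hG⟩ : ∃ v : Fin p → EuclideanSpace ℂ (Fin n),
      CompressedCRB.sensitivityMatrix x θ = CompressedCRB.colMatrix v :=
    ⟨fun j => WithLp.toLp 2 fun k => CompressedCRB.sensitivityMatrix x θ k j, rfl⟩
  rw [hG] at hJ ⊢
  have hv := (CompressedCRB.isUnit_fisherInformation_iff hσ v).1 hJ
  have hΦm := hΦ.aemeasurable
  set φ : Ω → Fin m → Fin n → ℂ := fun ω k l => Φ ω k l with hφ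
  -- All averaging is done under the law of `Φ` on its entries; measurable conclusions are pulled
  -- back to `Ω`.
  set ν := μ.map φ with hν
  have hνprob : IsProbabilityMeasure ν := Measure.isProbabilityMeasure_map hΦm
  have hinv : ∀ U ∈ Matrix.unitaryGroup (Fin n) ℂ,
      ν.map (fun A k l => (Matrix.of A * U) k l) = ν := fun U hU => by
    have hmeas : Measurable fun (A : Fin m → Fin n → ℂ) k l => (Matrix.of A * U) k l := by
      refine measurable_pi_lambda _ fun k => measurable_pi_lambda _ fun l => ?_
      exact CompressedCRB.measurable_mul_apply (CompressedCRB.measurable_of_apply measurable_id')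
        (B := fun _ => U) (fun i j => measurable_const) k l
    rw [hν, AEMeasurable.map_map_of_aemeasurable hmeas.aemeasurable hΦm]
    exact hΦ.map_mul_eq U hU
  have hrank : ∀ᵐ A ∂ν, IsUnit (Matrix.of A * (Matrix.of A)ᴴ) := by
    rw [hν, ae_map_iff hΦm]
    · exact hΦ_rank
    · have hA := CompressedCRB.measurable_of_apply (measurable_id' (α := Fin m → Fin n → ℂ))
      simp only [Matrix.isUnit_iff_isUnit_det, isUnit_iff_ne_zero]
      exact (CompressedCRB.measurable_det (CompressedCRB.measurable_mul_apply hA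
        (CompressedCRB.measurable_conjTranspose_apply hA)) (measurableSet_singleton 0)).compl
  set X : (Fin m → Fin n → ℂ) → ℝ := fun A => CompressedCRB.crb
    (CompressedCRB.compressedFisherInformation σ (Matrix.of A) (CompressedCRB.colMatrix v)) i
    with hX
  have hXm : Measurable X := CompressedCRB.measurable_crb_compressedFisherInformation σ
    (Φ := fun A : Fin m → Fin n → ℂ => Matrix.of A) (v := fun _ => v)
    (CompressedCRB.measurable_of_apply measurable_id') (fun _ => measurable_const) i
  have hX0 : ∀ A, 0 ≤ X A := fun A =>
    CompressedCRB.crb_compressedFisherInformation_nonneg hσ _ v i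
  set J := CompressedCRB.crb (CompressedCRB.fisherInformation σ (CompressedCRB.colMatrix v)) i
    with hJdef
  have hJ0 : 0 ≤ J := CompressedCRB.crb_fisherInformation_nonneg hσ v i
  have hYm : AEMeasurable (fun ω => X (φ ω)) μ := hXm.comp_aemeasurable hΦm
  have hmom : ∀ s : ℝ, 0 < s → s < (m : ℝ) - p + 1 → p ≤ m →
      ∫⁻ ω, ENNReal.ofReal (X (φ ω) ^ s) ∂μ = ENNReal.ofReal (J ^ s *
        ((Real.Gamma (m - p + 1 - s) / Real.Gamma (m - p + 1)) /
          (Real.Gamma (n - p + 1 - s) / Real.Gamma (n - p + 1)))) := fun s hs hsm hpm => by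
    rw [← CompressedCRB.lintegral_crb_rpow hinv hrank hσ hpm (by omega) hv i hs hsm, hν,
      lintegral_map' (hXm.pow_const s).ennreal_ofReal.aemeasurable hΦm]
  have hmn' : (m : ℝ) + p ≤ n := by exact_mod_cast hmn
  have hp0 : (0 : ℝ) ≤ p := p.cast_nonneg
  have hmean : p < m → Integrable (fun ω => X (φ ω)) μ ∧
      ∫ ω, X (φ ω) ∂μ = (((n : ℝ) - p) / ((m : ℝ) - p)) * J := fun hpm => by
    have hpm' : (p : ℝ) < m := by exact_mod_cast hpm
    -- The bound `s < m - p + 1` at `s = 1` is exactly `p < m`; at `s = 2` below it is `p + 1 < m`.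
    have h := hmom 1 one_pos (by linarith) hpm.le
    rw [CompressedCRB.Gamma_sub_one_div_Gamma (by linarith),
      CompressedCRB.Gamma_sub_one_div_Gamma (by linarith), Real.rpow_one] at h
    simp only [Real.rpow_one, add_sub_cancel_right] at h
    rw [div_div_div_eq, one_mul, mul_one, mul_comm] at h
    exact CompressedCRB.integrable_and_integral_eq_of_lintegral hYm.aestronglyMeasurable
      (fun ω => hX0 _)
      (mul_nonneg (div_nonneg (by linarith) (by linarith)) hJ0) h
  refine ⟨fun hpm => ⟨?_, hmean hpm⟩, fun hpm => ?_⟩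
  · exact ae_of_ae_map hΦm
      (CompressedCRB.ae_isUnit_compressedFisherInformation hinv hrank hσ p hpm.le v hv)
  · have hpm' : (p : ℝ) + 1 < m := by exact_mod_cast hpm
    have h := hmom 2 two_pos (by linarith) (by omega)
    rw [CompressedCRB.Gamma_sub_two_div_Gamma (by linarith),
      CompressedCRB.Gamma_sub_two_div_Gamma (by linarith), Real.rpow_two] at h
    simp only [Real.rpow_two] at h
    rw [div_div_div_eq, one_mul, mul_one] at h
    obtain ⟨hi, hint⟩ := CompressedCRB.integrable_and_integral_eq_of_lintegral
      (hYm.pow_const 2).aestronglyMeasurable (fun ω => sq_nonneg (X (φ ω)))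
      (mul_nonneg (sq_nonneg J) (div_nonneg (mul_nonneg (by linarith) (by linarith))
        (mul_nonneg (by linarith) (by linarith)))) h
    have hL2 : MemLp (fun ω => X (φ ω)) 2 μ :=
      (memLp_two_iff_integrable_sq hYm.aestronglyMeasurable).2 hi
    refine ⟨hL2, ?_⟩
    have hvar := variance_eq_sub hL2
    simp only [Pi.pow_apply] at hvar
    rw [hint, (hmean (by omega)).2] at hvar
    refine hvar.trans ?_
    have h1 : (m : ℝ) - p ≠ 0 := (show (0:ℝ) < _ by linarith).ne'
    have h2 : (m : ℝ) - p - 1 ≠ 0 := (show (0:ℝ) < _ by linarith).ne'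
    have h3 : (m : ℝ) - p + 1 - 1 ≠ 0 := (show (0:ℝ) < _ by linarith).ne'
    have h4 : (m : ℝ) - p + 1 - 2 ≠ 0 := (show (0:ℝ) < _ by linarith).ne'
    rw [show (m : ℝ) - p + 1 - 1 = m - p by ring, show (m : ℝ) - p + 1 - 2 = m - p - 1 by ring]
    field_simp
    ring
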